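/- \textbf{Setting.} In \emph{file caching}, each file $f$ has a positive integer size $\mathrm{size}(f)$ and a retrieval cost $\mathrm{cost}(f)\ge 0$. A finite sequence of requests $r$ is served with a cache of size $k$, initially empty: if the requested file is not in the cache, it is brought in at its retrieval cost, and other files are evicted so that the total size of the files in the cache is at most $k$. \emph{Paging} is the special case in which all sizes and costs are $1$. Let $\mathrm{cost}(A,k,r)$ be the cost incurred by algorithm $A$ on $r$ with a cache of size $k$, and $\mathrm{cost}(\mathrm{Opt},k,r)$ the minimum possible cost ($+\infty$ if some requested file has size greater than $k$). $A$ is \emph{$(\epsilon,\delta)$-loosely $c$-competitive} if for every positive integer $n$ and every request sequence $r$ (to files of arbitrary sizes and costs), at least $(1-\delta)n$ of the values $k\in\{1,\dots,n\}$ either are such that $r$ cannot be served with a cache of size $k$, or satisfy \[\mathrm{cost}(A,k,r)\le\max\Big\{c\cdot\mathrm{cost}(\mathrm{Opt},k,r),\ \epsilon\sum_{f\in r}\mathrm{cost}(f)\Big\},\] where the sum ranges over all requests in $r$. \textsc{Landlord} maintains a credit for each file in the cache. When $g$ is requested and is not in the cache, then until there is room for $g$ it repeats: decrease $\mathrm{credit}[f]$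 by $\Delta\cdot\mathrm{size}(f)$ for every $f$ in the cache, where $\Delta=\min_{f\in\text{cache}}\mathrm{credit}[f]/\mathrm{size}(f)$, and evict any subset of the files with zero credit; after that it brings $g$ in and sets $\mathrm{credit}[g]=\mathrm{cost}(g)$. If $g$ is in the cache, it resets $\mathrm{credit}[g]$ to any value between its current value and $\mathrm{cost}(g)$. A \emph{version} of \textsc{Landlord} is an algorithm that executes \textsc{Landlord} with some rule (possibly depending on the whole request sequence) for making these choices. For paging, \emph{flush-when-full} (FWF) empties the cache completely when an item not in the cache is requested and the cache is full; \emph{least-recently-used} (LRU) evicts the single least recently requested item instead. \textbf{Theorem.} For $0<\epsilon<1$ and $0<\delta<1/2$ let \[c=c(\epsilon,\delta)=\frac{1}{8\delta}\log_2\frac{1}{2\epsilon}.\] Then $c=\Theta\big(\frac1\delta\log\frac1\epsilon\big)$ as $\epsilon\to0$, uniformly in $\delta\in(0,1/2)$, and, for files from any infinite set: \begin{enumerate} \item \textsc{Landlord} is not $(\epsilon,\delta)$-loosely $c$-competitive: there is an on-line version of \textsc{Landlord}, coinciding with FWF for paging, that for no such $\epsilon,\delta$ is $(\epsilon,\delta)$-loosely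 $c(\epsilon,\delta)$-competitive. \item This holds even if eviction is one at a time: there is a version of \textsc{Landlord} that evicts exactly one file in each execution of the eviction step, that has the same cost as FWF on every paging sequence with every cache size $k\ge1$, and that for no such $\epsilon,\delta$ is $(\epsilon,\delta)$-loosely $c(\epsilon,\delta)$-competitive. \item For all such $\epsilon,\delta$ and all sufficiently large integers $n$ there is a paging request sequence $r$ such that for every cache size $k$ with $\lceil(1-\delta)n\rceil\le k\le n$, \[\mathrm{cost}(\mathrm{FWF},k,r)>c\cdot\mathrm{cost}(\mathrm{LRU},k,r)\quad\text{and}\quad \mathrm{cost}(\mathrm{FWF},k,r)>\epsilon\,|r|.\] \end{enumerate} -/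

import Mathlib

open scoped Topology Asymptotics

namespace FileCaching

/-- Files of type `F`: every file has a positive integer size and a non-negative retrieval cost. -/
structure FileSystem (F : Type*) where
  size : F → ℕ
  size_pos : ∀ f, 0 < size f
  cost : F → ℝ
  cost_nonneg : ∀ f, 0 ≤ cost f

/-- Paging: all sizes and all retrieval costs are `1`. -/
def paging (F : Type*) : FileSystem F where
  size _ := 1
  size_pos _ := Nat.one_pos
  cost _ := 1
  cost_nonneg _ := zero_le_one

section

variable {F : Type*} [DecidableEq F]

/-- The request sequence `r` can be served at all with a cache of size `k`:
every requested file fits into the cache. -/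
def Servable (S : FileSystem F) (k : ℕ) (r : List F) : Prop :=
  ∀ f ∈ r, S.size f ≤ k

/-- `IsSchedule S k C r Cs`: starting with cache contents `C`, the list `Cs` (the cache contents
after each of the requests of `r`) is a legal way to serve `r` with a cache of size `k`. After each
request the requested file is in the cache, no other file has been brought in, and the total size
is at most `k`. -/
def IsSchedule (S : FileSystem F) (k : ℕ) : Finset F → List F → List (Finset F) → Prop
  | _, [], [] => True
  | C, g :: r, D :: Cs =>
      g ∈ D ∧ D ⊆ insert g C ∧ ∑ f ∈ D, S.size f ≤ k ∧ IsSchedule S k D r Cs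
  | _, _, _ => False

/-- The total retrieval cost of serving `r` by the schedule `Cs`, starting with cache contents `C`:
a request costs nothing if the file is in the cache when it is requested, and the retrieval cost of
the file otherwise. -/
def scheduleCost (S : FileSystem F) : Finset F → List F → List (Finset F) → ℝ
  | C, g :: r, D :: Cs => (if g ∈ C then 0 else S.cost g) + scheduleCost S D r Cs
  | _, _, _ => 0

/-- `cost(Opt, k, r)`: the minimum cost of serving `r` with a cache of size `k`, initially empty.
(Only used when `r` is servable with cache size `k`.) -/
noncomputable def optCost (S : FileSystem F) (k : ℕ) (r : List F) : ℝ :=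
  sInf {x | ∃ Cs, IsSchedule S k ∅ r Cs ∧ x = scheduleCost S ∅ r Cs}

/-- A (deterministic) file caching algorithm: it serves every servable request sequence,
for every cache size, starting with the empty cache. -/
structure CachingAlg (F : Type*) [DecidableEq F] where
  schedule : FileSystem F → ℕ → List F → List (Finset F)
  valid : ∀ S k r, Servable S k r → IsSchedule S k ∅ r (schedule S k r)

/-- `cost(A, k, r)`. -/
def CachingAlg.cost (A : CachingAlg F) (S : FileSystem F) (k : ℕ) (r : List F) : ℝ :=
  scheduleCost S ∅ r (A.schedule S k r)

/-- The algorithm is on-line: its response to a request does not depend on later requests. -/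
def CachingAlg.OnLine (A : CachingAlg F) : Prop :=
  ∀ S k r r', A.schedule S k r <+: A.schedule S k (r ++ r')

/-- `(ε, δ, n)`-loose `c`-competitiveness: for any files and any request sequence, at least
`(1 - δ) n` of the values `k ∈ {1, …, n}` satisfy the bound. A value `k` for which the sequence
cannot be served by any algorithm (the optimum being infinite) counts as satisfying it. -/
def LooselyCompetitiveAt (A : CachingAlg F) (ε δ : ℝ) (n : ℕ) (c : ℝ) : Prop :=
  ∀ (S : FileSystem F) (r : List F),
    (1 - δ) * (n : ℝ) ≤
      (({k : ℕ | 1 ≤ k ∧ k ≤ n ∧ (Servable S k r →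
        A.cost S k r ≤ max (c * optCost S k r) (ε * (r.map S.cost).sum))}.ncard : ℕ) : ℝ)

/-- `(ε, δ)`-loose `c`-competitiveness. -/
def LooselyCompetitive (A : CachingAlg F) (ε δ c : ℝ) : Prop :=
  ∀ n : ℕ, 0 < n → LooselyCompetitiveAt A ε δ n c

/-! ### The algorithm Landlord

Landlord leaves some choices open (which zero-credit files to evict; to which value to reset the
credit of a requested file in the cache), so it is given as a transition relation. The parameter
`P` restricts the sets of files that may be evicted in one execution of the eviction step. -/

/-- The cache contents and the credits (only the credits of files in the cache matter). -/
structure LandlordState (F : Type*) where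
  cache : Finset F
  credit : F → ℝ

/-- There is room for `g` in a cache of size `k`. -/
def HasRoom (S : FileSystem F) (k : ℕ) (g : F) (s : LandlordState F) : Prop :=
  ∑ f ∈ s.cache, S.size f + S.size g ≤ k

/-- One iteration of the inner loop: the credit of each file `f` in the cache decreases by
`Δ * size f`, where `Δ` is the least value of `credit f / size f` over the cache, and then a subset
`E` of the files with zero credit is evicted. -/
def RentEvict (S : FileSystem F) (P : Finset F → Prop) (s t : LandlordState F) : Prop :=
  ∃ Δ : ℝ, IsLeast ((fun f => s.credit f / (S.size f : ℝ)) '' (s.cache : Set F)) Δ ∧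
    (∀ f ∈ s.cache, t.credit f = s.credit f - Δ * (S.size f : ℝ)) ∧
    ∃ E : Finset F, E ⊆ s.cache ∧ (∀ f ∈ E, t.credit f = 0) ∧ P E ∧ t.cache = s.cache \ E

/-- The inner loop: iterate `RentEvict` until there is room for `g`. -/
inductive MakeRoom (S : FileSystem F) (P : Finset F → Prop) (k : ℕ) (g : F) :
    LandlordState F → LandlordState F → Prop
  | done (s : LandlordState F) : HasRoom S k g s → MakeRoom S P k g s s
  | loop (s t u : LandlordState F) : ¬ HasRoom S k g s → RentEvict S P s t →
      MakeRoom S P k g t u → MakeRoom S P k g s u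

/-- The response of Landlord to a request to `g`. -/
def LandlordStep (S : FileSystem F) (P : Finset F → Prop) (k : ℕ)
    (s : LandlordState F) (g : F) (t : LandlordState F) : Prop :=
  (g ∉ s.cache ∧ ∃ u, MakeRoom S P k g s u ∧ t.cache = insert g u.cache ∧
      t.credit g = S.cost g ∧ ∀ f ∈ u.cache, t.credit f = u.credit f) ∨
  (g ∈ s.cache ∧ t.cache = s.cache ∧
      s.credit g ≤ t.credit g ∧ t.credit g ≤ S.cost g ∧
      ∀ f ∈ s.cache, f ≠ g → t.credit f = s.credit f)

/-- `Cs` is the list of the cache contents after each request in some execution of Landlord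
on `r`, started in the state `s`. -/
inductive LandlordRun (S : FileSystem F) (P : Finset F → Prop) (k : ℕ) :
    LandlordState F → List F → List (Finset F) → Prop
  | nil (s : LandlordState F) : LandlordRun S P k s [] []
  | cons (s t : LandlordState F) (g : F) (r : List F) (Cs : List (Finset F)) :
      LandlordStep S P k s g t → LandlordRun S P k t r Cs →
      LandlordRun S P k s (g :: r) (t.cache :: Cs)

/-- `A` is a version of Landlord: on every servable input it executes Landlord, with some way of
making the choices that Landlord leaves open. -/
def IsLandlord (A : CachingAlg F) : Prop :=
  ∀ S k r, Servable S k r → LandlordRun S (fun _ => True) k ⟨∅, fun _ => 0⟩ r (A.schedule S k r)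

/-- `A` is a version of Landlord that evicts only one file at a time (and hence, as the inner loop
ends as soon as there is room, only as many as it takes to make room). -/
def IsOneAtATimeLandlord (A : CachingAlg F) : Prop :=
  ∀ S k r, Servable S k r →
    LandlordRun S (fun E => E.card = 1) k ⟨∅, fun _ => 0⟩ r (A.schedule S k r)

/-! ### Flush-when-full and least-recently-used (paging strategies) -/

/-- Flush-when-full: if the requested item is not in the cache and the cache is full, the cache is
emptied completely before the item is brought in. -/
def fwfStep (k : ℕ) (C : Finset F) (g : F) : Finset F :=
  if g ∈ C then C else if C.card < k then insert g C else {g}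

/-- The cache contents of flush-when-full after each request. -/
def fwfSchedule (k : ℕ) (r : List F) : List (Finset F) :=
  (r.scanl (fwfStep k) ∅).tail

/-- The number of faults of flush-when-full with cache size `k` on `r`. -/
def fwfCost (k : ℕ) (r : List F) : ℝ :=
  scheduleCost (paging F) ∅ r (fwfSchedule k r)

/-- Least-recently-used. The state lists the items in the cache, the most recently requested first;
if the cache overflows, the last item of the list is evicted. -/
def lruStep (k : ℕ) (L : List F) (g : F) : List F :=
  (g :: L.erase g).take k

/-- The cache contents of least-recently-used after each request. -/
def lruSchedule (k : ℕ) (r : List F) : List (Finset F) :=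
  ((r.scanl (lruStep k) []).tail).map List.toFinset

/-- The number of faults of least-recently-used with cache size `k` on `r`. -/
def lruCost (k : ℕ) (r : List F) : ℝ :=
  scheduleCost (paging F) ∅ r (lruSchedule k r)

end

/-- The ratio `c = (1 / (8 δ)) log₂ (1 / (2 ε))`. -/
noncomputable def tightRatio (ε δ : ℝ) : ℝ :=
  1 / (8 * δ) * Real.logb 2 (1 / (2 * ε))

end FileCaching

open FileCaching

namespace FileCaching

section Sequences

variable {F : Type*} [DecidableEq F]

/-! ### Costs of flush-when-full and least-recently-used from an arbitrary state -/

/-! For paging, flush-when-full (FWF) is a version of Landlord, so the negative results come down to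
one paging sequence on which FWF does badly for all large cache sizes at once. The sequence is made
of passes down the stack of most recently requested items. The LRU cache is the top `k` of that
stack, so a pass over the top `N` items costs LRU at most `N - k` faults (`lru_pass`). If `N > k`,
FWF has to flush and pays `k`, amortized with the number of cached items as potential
(`fwfCostFrom_amortized`).

A single `N` only hurts the values of `k` just below it. To cover a window of width about `δ n`,
there are `L` levels of passes with lengths spaced `b ≈ δ n / L` apart, and the number of passes
doubles from each level to the next shorter one. For a given `k`, passes of length at most `k` cost
LRU nothing, and among the longer ones those closest to `k` dominate, so the mean excess over `k` is
at most `2 b` (`exists_passLengths_bounds`). With `k > n / 2` the ratio is about `k / (2 b)`, hence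
about `L / (4 δ)`. For `k` near `n` only the longest passes count, about a fraction `2 ^ (-L)` of
all; keeping FWF above `ε |r|` therefore limits `L` to about `log₂ (1 / (2 ε))`.

Evicting all zero-credit files reproduces FWF, because the cached files all have credit `1`. When
files are evicted singly, zero-credit leftovers stay in the cache; evicting the one requested
soonest ensures that no leftover ever serves a request (`Simulates.step`). -/

theorem scheduleCost_nonneg (S : FileSystem F) (C : Finset F) (r : List F) (Cs : List (Finset F)) :
    0 ≤ scheduleCost S C r Cs := by
  induction r generalizing C Cs with
  | nil => simp [scheduleCost]
  | cons g r ih =>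
    cases Cs with
    | nil => simp [scheduleCost]
    | cons D Cs =>
      have h := ih D Cs
      have h' := S.cost_nonneg g
      simp only [scheduleCost]
      split_ifs <;> linarith

/-- The number of faults of flush-when-full started with cache contents `C`. -/
def fwfCostFrom (k : ℕ) : Finset F → List F → ℝ
  | _, [] => 0
  | C, g :: r => (if g ∈ C then 0 else 1) + fwfCostFrom k (fwfStep k C g) r

/-- The number of faults of least-recently-used started with the list `L` of items. -/
def lruCostFrom (k : ℕ) : List F → List F → ℝ
  | _, [] => 0
  | L, g :: r => (if g ∈ L then 0 else 1) + lruCostFrom k (lruStep k L g) r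

theorem tail_scanl_cons {α β : Type*} (f : β → α → β) (b : β) (a : α) (l : List α) :
    ((a :: l).scanl f b).tail = f b a :: (l.scanl f (f b a)).tail := by
  cases l <;> simp [List.scanl_cons]

theorem scheduleCost_fwf (k : ℕ) (C : Finset F) (r : List F) :
    scheduleCost (paging F) C r ((r.scanl (fwfStep k) C).tail) = fwfCostFrom k C r := by
  induction r generalizing C with
  | nil => simp [scheduleCost, fwfCostFrom]
  | cons g r ih => rw [tail_scanl_cons, scheduleCost, ih]; rfl

theorem fwfCost_eq (k : ℕ) (r : List F) : fwfCost k r = fwfCostFrom k ∅ r :=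
  scheduleCost_fwf k ∅ r

theorem scheduleCost_lru (k : ℕ) (L : List F) (r : List F) :
    scheduleCost (paging F) L.toFinset r (((r.scanl (lruStep k) L).tail).map List.toFinset) =
      lruCostFrom k L r := by
  induction r generalizing L with
  | nil => simp [scheduleCost, lruCostFrom]
  | cons g r ih =>
    rw [tail_scanl_cons, List.map_cons, scheduleCost, ih]
    simp [lruCostFrom, paging]

theorem lruCost_eq (k : ℕ) (r : List F) : lruCost k r = lruCostFrom k [] r :=
  scheduleCost_lru k [] r

theorem fwfCostFrom_append (k : ℕ) (C : Finset F) (r r' : List F) :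
    fwfCostFrom k C (r ++ r') = fwfCostFrom k C r + fwfCostFrom k (r.foldl (fwfStep k) C) r' := by
  induction r generalizing C with
  | nil => simp [fwfCostFrom]
  | cons g r ih => simp [fwfCostFrom, ih, add_assoc]

theorem lruCostFrom_append (k : ℕ) (L : List F) (r r' : List F) :
    lruCostFrom k L (r ++ r') = lruCostFrom k L r + lruCostFrom k (r.foldl (lruStep k) L) r' := by
  induction r generalizing L with
  | nil => simp [lruCostFrom]
  | cons g r ih => simp [lruCostFrom, ih, add_assoc]

theorem lruCostFrom_le_length (k : ℕ) (L : List F) (r : List F) :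
    lruCostFrom k L r ≤ r.length := by
  induction r generalizing L with
  | nil => simp [lruCostFrom]
  | cons g r ih =>
    have h := ih (lruStep k L g)
    simp only [lruCostFrom, List.length_cons, Nat.cast_add, Nat.cast_one]
    split_ifs <;> linarith

/-! ### The optimum is at most the cost of least-recently-used -/

theorem isSchedule_lru {k : ℕ} (hk : 0 < k) (L : List F) (r : List F) :
    IsSchedule (paging F) k L.toFinset r (((r.scanl (lruStep k) L).tail).map List.toFinset) := by
  induction r generalizing L with
  | nil => simp [IsSchedule]
  | cons g r ih =>
    rw [tail_scanl_cons, List.map_cons]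
    refine ⟨?_, ?_, ?_, ih _⟩
    · obtain ⟨m, rfl⟩ : ∃ m, k = m + 1 := ⟨k - 1, by omega⟩
      simp [lruStep]
    · intro f hf
      have hf' := List.mem_of_mem_take (List.mem_toFinset.mp hf)
      rcases List.mem_cons.mp hf' with rfl | h
      · simp
      · simp [List.mem_of_mem_erase h]
    · have h := List.toFinset_card_le (lruStep k L g)
      have h' : (lruStep k L g).length ≤ k := by simp [lruStep]
      simpa [paging] using h.trans h'

theorem optCost_nonneg (S : FileSystem F) (k : ℕ) (r : List F) : 0 ≤ optCost S k r := by
  apply Real.sInf_nonneg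
  rintro x ⟨Cs, -, rfl⟩
  exact scheduleCost_nonneg _ _ _ _

theorem optCost_le_lruCost {k : ℕ} (hk : 0 < k) (r : List F) :
    optCost (paging F) k r ≤ lruCost k r := by
  refine csInf_le ⟨0, ?_⟩ ⟨lruSchedule k r, isSchedule_lru hk [] r, rfl⟩
  rintro x ⟨Cs, -, rfl⟩
  exact scheduleCost_nonneg _ _ _ _

/-! ### A pass over more than `k` items costs flush-when-full at least `k` faults, amortized -/

theorem card_fwfStep_le {k : ℕ} (hk : 0 < k) {C : Finset F} (hC : C.card ≤ k) (g : F) :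
    (fwfStep k C g).card ≤ k := by
  unfold fwfStep
  split_ifs with h h'
  · exact hC
  · rw [Finset.card_insert_of_notMem h]; omega
  · rw [Finset.card_singleton]; exact hk

theorem card_foldl_fwfStep_le {k : ℕ} (hk : 0 < k) {C : Finset F} (hC : C.card ≤ k) (p : List F) :
    (p.foldl (fwfStep k) C).card ≤ k := by
  induction p generalizing C with
  | nil => simpa using hC
  | cons g p ih => exact ih (card_fwfStep_le hk hC g)

/-- Either flush-when-full does not flush on `p`, or it faults at least `k` times, up to the change
in the number of items in the cache. -/
theorem fwfCostFrom_amortized {k : ℕ} (hk : 0 < k) {C : Finset F} (hC : C.card ≤ k) (p : List F) :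
    ((p.foldl (fwfStep k) C).card : ℝ) ≤ fwfCostFrom k C p + C.card ∧
    (C ∪ p.toFinset ⊆ p.foldl (fwfStep k) C ∨
      (k : ℝ) + (p.foldl (fwfStep k) C).card ≤ fwfCostFrom k C p + C.card) := by
  induction p generalizing C with
  | nil => simp [fwfCostFrom]
  | cons g p ih =>
    obtain ⟨h1, h2⟩ := ih (card_fwfStep_le hk hC g)
    simp only [List.foldl_cons, fwfCostFrom]
    by_cases hg : g ∈ C
    · have hs : fwfStep k C g = C := if_pos hg
      rw [hs] at h1 h2 ⊢
      simp only [hg, if_true, zero_add]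
      refine ⟨h1, h2.imp_left fun h => ?_⟩
      intro f hf
      apply h
      simp only [List.toFinset_cons, Finset.mem_union, Finset.mem_insert] at hf ⊢
      rcases hf with hf | rfl | hf <;> tauto
    by_cases hlt : C.card < k
    · have hs : fwfStep k C g = insert g C := by simp [fwfStep, hg, hlt]
      rw [hs] at h1 h2 ⊢
      rw [Finset.card_insert_of_notMem hg] at h1 h2
      push_cast at h1 h2
      simp only [hg, if_false]
      refine ⟨by linarith, h2.imp (fun h => ?_) fun h => by linarith⟩
      intro f hf
      apply h
      simp only [List.toFinset_cons, Finset.mem_union, Finset.mem_insert] at hf ⊢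
      tauto
    -- A flush is one fault, and the potential falls from `k` to `1`: this fall is the gain of `k`.
    · have hs : fwfStep k C g = {g} := by simp [fwfStep, hg, hlt]
      have hCk : (C.card : ℝ) = k := by exact_mod_cast le_antisymm hC (not_lt.mp hlt)
      rw [hs] at h1 h2 ⊢
      simp only [hg, if_false, Finset.card_singleton, Nat.cast_one] at h1 ⊢
      have hk' : (0 : ℝ) ≤ k := Nat.cast_nonneg k
      exact ⟨by linarith, Or.inr (by linarith)⟩

/-- Without a flush all items of `p` would be in the final cache, which is too small for them. -/
theorem le_fwfCostFrom_of_lt_card {k : ℕ} (hk : 0 < k) {C : Finset F} (hC : C.card ≤ k)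
    {p : List F} (hp : k < p.toFinset.card) :
    (k : ℝ) + (p.foldl (fwfStep k) C).card ≤ fwfCostFrom k C p + C.card := by
  refine (fwfCostFrom_amortized hk hC p).2.resolve_left fun h => ?_
  have h1 := Finset.card_le_card (Finset.subset_union_right.trans h)
  have h2 := card_foldl_fwfStep_le hk hC p
  omega

/-! ### Least-recently-used on a pass down its stack -/

/-- Moving an item to the front commutes with truncating the stack to its first `k` entries. If `a`
is shorter than `k`, the request is a hit; otherwise it is a miss and the `k`-th entry drops out. -/
theorem lruStep_take {k : ℕ} {a c : List F} {g : F} (hg : g ∉ a) :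
    lruStep k ((a ++ g :: c).take k) g = (g :: (a ++ c)).take k := by
  unfold lruStep
  rcases lt_or_ge a.length k with h | h
  · obtain ⟨m, hm⟩ : ∃ m, k = a.length + m + 1 := ⟨k - a.length - 1, by omega⟩
    have h1 : (a ++ g :: c).take k = a ++ g :: c.take m := by
      rw [List.take_append, List.take_of_length_le h.le,
        show k - a.length = m + 1 by omega, List.take_succ_cons]
    rw [h1, List.erase_append_right _ hg, List.erase_cons_head, hm, List.take_succ_cons,
      List.take_succ_cons]
    simp [List.take_append]
  · rw [List.take_append_of_le_length h,
      List.erase_of_not_mem fun h' => hg (List.mem_of_mem_take h')]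
    cases k with
    | zero => simp
    | succ k =>
      rw [List.take_succ_cons, List.take_succ_cons, List.take_take,
        List.take_append_of_le_length (by omega)]
      simp

theorem mem_take_append_cons {α : Type*} {k : ℕ} {a c : List α} {g : α} (h : a.length < k) :
    g ∈ (a ++ g :: c).take k := by
  obtain ⟨m, hm⟩ : ∃ m, k - a.length = m + 1 := ⟨k - a.length - 1, by omega⟩
  rw [List.take_append, hm, List.take_succ_cons]
  simp

/-- If the items of the cache are the first `k` items of the stack `a ++ p ++ c`, then the requests
`p` move `p`, reversed, to the top of the stack. -/
theorem lru_pass {k : ℕ} {a p c : List F} (h : (a ++ (p ++ c)).Nodup) :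
    p.foldl (lruStep k) ((a ++ (p ++ c)).take k) = (p.reverse ++ (a ++ c)).take k ∧
    lruCostFrom k ((a ++ (p ++ c)).take k) p ≤ ((p.length - (k - a.length) : ℕ) : ℝ) := by
  induction p generalizing a with
  | nil => simp [lruCostFrom]
  | cons g p ih =>
    have hperm : (a ++ g :: (p ++ c)).Perm (g :: (a ++ (p ++ c))) := List.perm_middle
    have hnd : ((g :: a) ++ (p ++ c)).Nodup := hperm.nodup_iff.mp h
    have hg : g ∉ a := fun h' => (List.nodup_cons.mp hnd).1 (List.mem_append_left _ h')
    obtain ⟨h1, h2⟩ := ih hnd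
    have hs : lruStep k ((a ++ (g :: p ++ c)).take k) g = ((g :: a) ++ (p ++ c)).take k :=
      lruStep_take hg
    rw [List.foldl_cons, lruCostFrom, hs]
    refine ⟨by rw [h1]; simp, ?_⟩
    simp only [List.length_cons] at h2 ⊢
    split_ifs with hmem
    · rw [zero_add]
      refine h2.trans (Nat.cast_le.mpr ?_)
      omega
    -- After the first miss the requests lie ever deeper relative to the cache, so both truncated
    -- differences `k - _` vanish.
    · have hle : k ≤ a.length := by
        by_contra hlt
        exact hmem (mem_take_append_cons (not_le.mp hlt))
      have h3 : ((p.length - (k - (a.length + 1)) : ℕ) : ℝ) + 1 =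
          ((p.length + 1 - (k - a.length) : ℕ) : ℝ) := by
        rw [Nat.sub_eq_zero_of_le hle, Nat.sub_eq_zero_of_le (by omega : k ≤ a.length + 1)]
        simp
      linarith

/-- Fresh items are pushed on top of the stack. With `a = []` this gives the state in which the
zigzag starts. -/
theorem lru_cold {k : ℕ} {a p : List F} (h : (p.reverse ++ a).Nodup) :
    p.foldl (lruStep k) (a.take k) = (p.reverse ++ a).take k := by
  induction p generalizing a with
  | nil => simp
  | cons g p ih =>
    have h' : (p.reverse ++ (g :: a)).Nodup := by simpa using h
    have hg : g ∉ a := (List.nodup_cons.mp (List.Nodup.of_append_right h')).1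
    have hs : lruStep k (a.take k) g = (g :: a).take k := by
      rw [lruStep, List.erase_of_not_mem fun h' => hg (List.mem_of_mem_take h')]
      cases k with
      | zero => simp
      | succ k => simp [List.take_take]
    rw [List.foldl_cons, hs, ih h']
    simp

/-! ### The zigzag sequence -/

/-- For each `N` in the list, request the `N` topmost items of the stack, from the top downwards,
which reverses the order of these items in the stack. -/
def zigzag : List ℕ → List F → List F
  | [], _ => []
  | N :: ns, σ => σ.take N ++ zigzag ns ((σ.take N).reverse ++ σ.drop N)

theorem reverse_take_append_drop_perm {α : Type*} (N : ℕ) (σ : List α) :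
    ((σ.take N).reverse ++ σ.drop N).Perm σ := by
  have h := (List.reverse_perm (σ.take N)).append_right (σ.drop N)
  rwa [List.take_append_drop] at h

theorem length_zigzag_le {α : Type*} (ns : List ℕ) (σ : List α) : (zigzag ns σ).length ≤ ns.sum := by
  induction ns generalizing σ with
  | nil => simp [zigzag]
  | cons N ns ih =>
    have h := ih ((σ.take N).reverse ++ σ.drop N)
    simp only [zigzag, List.length_append, List.sum_cons, List.length_take] at h ⊢
    omega

theorem lruCostFrom_zigzag_le (k : ℕ) (ns : List ℕ) {σ : List F} (hσ : σ.Nodup) :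
    lruCostFrom k (σ.take k) (zigzag ns σ) ≤ (((ns.map fun N => N - k).sum : ℕ) : ℝ) := by
  induction ns generalizing σ with
  | nil => simp [zigzag, lruCostFrom]
  | cons N ns ih =>
    have hn : ([] ++ (σ.take N ++ σ.drop N)).Nodup := by simpa using hσ
    obtain ⟨h1, h2⟩ := lru_pass (k := k) hn
    simp only [List.nil_append, List.take_append_drop, List.length_nil] at h1 h2
    have h3 := ih ((reverse_take_append_drop_perm N σ).nodup_iff.mpr hσ)
    rw [zigzag, lruCostFrom_append, h1, List.map_cons, List.sum_cons, Nat.cast_add]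
    refine add_le_add (h2.trans (Nat.cast_le.mpr ?_)) h3
    rw [List.length_take]
    omega

/-- The potential telescopes over the passes: a long pass gains `k`, a short one loses nothing. The
bound on the lengths makes `σ.take N` consist of exactly `N` items. -/
theorem le_fwfCostFrom_zigzag {k : ℕ} (hk : 0 < k) (ns : List ℕ) {σ : List F} (hσ : σ.Nodup)
    (hns : ∀ N ∈ ns, N ≤ σ.length) {C : Finset F} (hC : C.card ≤ k) :
    (k : ℝ) * (((ns.map fun N => if k < N then 1 else 0).sum : ℕ) : ℝ) ≤
      fwfCostFrom k C (zigzag ns σ) + C.card := by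
  induction ns generalizing σ C with
  | nil => simp [zigzag, fwfCostFrom]
  | cons N ns ih =>
    have hperm := reverse_take_append_drop_perm N σ
    have h3 := ih (hperm.nodup_iff.mpr hσ)
      (fun M hM => hperm.length_eq ▸ hns M (List.mem_cons_of_mem _ hM))
      (card_foldl_fwfStep_le hk hC (σ.take N))
    rw [zigzag, fwfCostFrom_append, List.map_cons, List.sum_cons, Nat.cast_add, mul_add]
    split_ifs with hN
    · have hcard : k < (σ.take N).toFinset.card := by
        rw [List.toFinset_card_of_nodup (hσ.sublist (List.take_sublist _ _)), List.length_take,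
          min_eq_left (hns N (List.mem_cons_self ..))]
        exact hN
      have h4 := le_fwfCostFrom_of_lt_card hk hC hcard
      push_cast at h3 h4 ⊢
      linarith
    · have h4 := (fwfCostFrom_amortized hk hC (σ.take N)).1
      push_cast at h3 h4 ⊢
      linarith

/-- The lengths of the passes: `2 ^ j * T` passes of length `n + 1 - j * b`, for each `j < L`. -/
def passLengths (n b T L : ℕ) : List ℕ :=
  (List.range L).flatMap fun j => List.replicate (2 ^ j * T) (n + 1 - j * b)

theorem sum_map_passLengths (f : ℕ → ℕ) (n b T L : ℕ) :
    ((passLengths n b T L).map f).sum =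
      ∑ j ∈ Finset.range L, 2 ^ j * T * f (n + 1 - j * b) := by
  unfold passLengths
  induction L with
  | zero => simp
  | succ L ih =>
    rw [List.range_succ, List.flatMap_append, List.map_append, List.sum_append, ih,
      Finset.sum_range_succ]
    simp

theorem le_of_mem_passLengths {n b T L N : ℕ} (h : N ∈ passLengths n b T L) : N ≤ n + 1 := by
  simp only [passLengths, List.mem_flatMap, List.mem_replicate] at h
  obtain ⟨j, -, -, rfl⟩ := h
  omega

/-- This is the weighted excess, in units of `b`, of the levels above `k`. It is at most `2 * (2 ^ M
- 1)`, twice the number of passes, which is the source of the mean excess `2 b`. -/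
theorem sum_two_pow_mul_sub (M : ℕ) :
    ∑ j ∈ Finset.range M, 2 ^ j * (M - j) + M + 2 = 2 ^ (M + 1) := by
  induction M with
  | zero => simp
  | succ M ih =>
    have h : ∑ j ∈ Finset.range M, 2 ^ (j + 1) * (M + 1 - (j + 1)) =
        2 * ∑ j ∈ Finset.range M, 2 ^ j * (M - j) := by
      rw [Finset.mul_sum]
      refine Finset.sum_congr rfl fun j _ => ?_
      rw [Nat.add_sub_add_right]; ring
    rw [Finset.sum_range_succ', h, pow_succ 2 (M + 1), ← ih]
    simp
    ring

theorem sum_two_pow (M : ℕ) : ∑ j ∈ Finset.range M, 2 ^ j = 2 ^ M - 1 := by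
  have h := Nat.geomSum_eq (le_refl 2) M
  simpa using h

/-- For a cache size `k`, the passes longer than `k` are the first `M` kinds of passes; their
number bounds the faults of both strategies. -/
theorem exists_passLengths_bounds {n b T L k : ℕ} (hL : 0 < L) (hb : 0 < b) (hk : k ≤ n)
    (hLb : n + 1 ≤ k + L * b) :
    ∃ M, 0 < M ∧
      ((passLengths n b T L).map fun N => N - k).sum ≤ 2 * b * (T * (2 ^ M - 1)) ∧
      T * (2 ^ M - 1) ≤ ((passLengths n b T L).map fun N => if k < N then 1 else 0).sum := by
  have hdiv : n - k < ((n - k) / b + 1) * b := by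
    have := Nat.lt_div_mul_add (a := n - k) hb
    rw [add_mul, one_mul]; exact this
  have hdiv' : (n - k) / b * b ≤ n - k := Nat.div_mul_le_self _ _
  -- Level `j` has length above `k` exactly if `j * b ≤ n - k`, that is, `j ≤ (n - k) / b`.
  obtain ⟨M, hM⟩ : ∃ M, M = min L ((n - k) / b + 1) := ⟨_, rfl⟩
  have hML : M ≤ L := hM ▸ min_le_left _ _
  have hMd : M ≤ (n - k) / b + 1 := hM ▸ min_le_right _ _
  have hM0 : 0 < M := by rw [hM]; positivity
  have hMb : n + 1 ≤ k + M * b := by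
    rcases min_choice L ((n - k) / b + 1) with h | h <;> rw [h] at hM <;> rw [hM] <;> omega
  have hsub : Finset.range M ⊆ Finset.range L := Finset.range_subset_range.mpr hML
  refine ⟨M, hM0, ?_, ?_⟩
  · rw [sum_map_passLengths, ← Finset.sum_subset hsub]
    · have hterm : ∀ j ∈ Finset.range M,
          2 ^ j * T * (n + 1 - j * b - k) ≤ b * T * (2 ^ j * (M - j)) := by
        intro j hj
        have hjM := Finset.mem_range.mp hj
        have h1 : n + 1 - j * b - k ≤ (M - j) * b := by
          rw [Nat.sub_mul]; omega
        calc 2 ^ j * T * (n + 1 - j * b - k) ≤ 2 ^ j * T * ((M - j) * b) :=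
              Nat.mul_le_mul_left _ h1
          _ = _ := by ring
      refine (Finset.sum_le_sum hterm).trans ?_
      rw [← Finset.mul_sum]
      have h2 := sum_two_pow_mul_sub M
      have h3 : ∑ j ∈ Finset.range M, 2 ^ j * (M - j) ≤ 2 * (2 ^ M - 1) := by
        rw [pow_succ] at h2; omega
      calc b * T * ∑ j ∈ Finset.range M, 2 ^ j * (M - j) ≤ b * T * (2 * (2 ^ M - 1)) :=
            Nat.mul_le_mul_left _ h3
        _ = _ := by ring
    · intro j _ hj
      have hj' : M ≤ j := not_lt.mp fun h => hj (Finset.mem_range.mpr h)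
      have h1 := Nat.mul_le_mul_right b hj'
      have h2 : n + 1 - j * b - k = 0 := by omega
      rw [h2, mul_zero]
  · rw [sum_map_passLengths, ← sum_two_pow, Finset.mul_sum]
    refine le_trans (Finset.sum_le_sum fun j hj => ?_)
      (Finset.sum_le_sum_of_subset hsub)
    have hj' : j ≤ (n - k) / b := by have := Finset.mem_range.mp hj; omega
    have h1 := Nat.mul_le_mul_right b hj'
    rw [if_pos (by omega)]
    exact le_of_eq (by ring)

/-! ### Flush-when-full against least-recently-used -/

theorem exists_nodup_length (α : Type*) [Infinite α] (m : ℕ) :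
    ∃ σ : List α, σ.Nodup ∧ σ.length = m :=
  ⟨(List.range m).map (Infinite.natEmbedding α),
    List.nodup_range.map (Infinite.natEmbedding α).injective, by simp⟩

/-- Bounds on the costs on a zigzag sequence. -/
theorem exists_sequence [Infinite F] {n b L : ℕ} (hL : 0 < L) (hb : 0 < b) :
    ∃ r : List F,
      (r.length : ℝ) ≤ (n + 1) * (1 + (n + 1) * (2 ^ L - 1)) ∧
      ∀ k : ℕ, 0 < k → k ≤ n → n + 1 ≤ k + L * b →
        ∃ Q : ℝ, (n + 1 : ℝ) ≤ Q ∧ lruCost k r ≤ (n + 1) + 2 * b * Q ∧ k * Q ≤ fwfCost k r := by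
  -- With `n + 1` items the longest pass exceeds even `k = n`. The factor `T = n + 1` makes `Q` at
  -- least the `n + 1` faults of the cold start.
  obtain ⟨σ, hσ, hlen⟩ := exists_nodup_length F (n + 1)
  refine ⟨σ ++ zigzag (passLengths n b (n + 1) L) σ.reverse, ?_, ?_⟩
  · have h1 := length_zigzag_le (passLengths n b (n + 1) L) σ.reverse
    have h2 : (passLengths n b (n + 1) L).sum ≤ (n + 1) * (n + 1) * (2 ^ L - 1) := by
      have h := sum_map_passLengths id n b (n + 1) L
      rw [List.map_id] at h
      rw [h, ← sum_two_pow, Finset.mul_sum]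
      refine Finset.sum_le_sum fun j _ => ?_
      have h3 : id (n + 1 - j * b) ≤ n + 1 := Nat.sub_le _ _
      calc 2 ^ j * (n + 1) * id (n + 1 - j * b) ≤ 2 ^ j * (n + 1) * (n + 1) :=
            Nat.mul_le_mul_left _ h3
        _ = _ := by ring
    have h3 : (σ ++ zigzag (passLengths n b (n + 1) L) σ.reverse).length ≤
        (n + 1) + (n + 1) * (n + 1) * (2 ^ L - 1) := by
      rw [List.length_append, hlen]; omega
    have h4 : (((n + 1) + (n + 1) * (n + 1) * (2 ^ L - 1) : ℕ) : ℝ) =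
        (n + 1) * (1 + (n + 1) * (2 ^ L - 1)) := by
      push_cast [Nat.one_le_two_pow]; ring
    rw [← h4]
    exact Nat.cast_le.mpr h3
  · intro k hk hkn hLb
    obtain ⟨M, hM, hlru, hfwf⟩ := exists_passLengths_bounds (T := n + 1) hL hb hkn hLb
    refine ⟨((n + 1) * (2 ^ M - 1) : ℕ), ?_, ?_, ?_⟩
    · have h1 : 2 ≤ 2 ^ M := Nat.le_self_pow hM.ne' 2
      have h2 : (n + 1) * 1 ≤ (n + 1) * (2 ^ M - 1) := Nat.mul_le_mul_left _ (by omega)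
      rw [mul_one] at h2
      exact_mod_cast h2
    · have h1 := lruCostFrom_le_length k [] σ
      have h2 : σ.foldl (lruStep k) [] = σ.reverse.take k := by
        have := lru_cold (k := k) (a := []) (p := σ) (by simpa using hσ)
        simpa using this
      have h3 := lruCostFrom_zigzag_le k (passLengths n b (n + 1) L) (List.nodup_reverse.mpr hσ)
      rw [lruCost_eq, lruCostFrom_append, h2]
      rw [hlen] at h1
      have h4 : (((passLengths n b (n + 1) L).map fun N => N - k).sum : ℝ) ≤
          2 * b * ((n + 1) * (2 ^ M - 1) : ℕ) := by exact_mod_cast hlru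
      push_cast at h1 h3 h4 ⊢
      linarith
    · have h1 := le_fwfCostFrom_zigzag hk (passLengths n b (n + 1) L) (List.nodup_reverse.mpr hσ)
        (fun N hN => by rw [List.length_reverse, hlen]; exact le_of_mem_passLengths hN)
        (card_foldl_fwfStep_le hk (C := ∅) (by simp) σ)
      -- The faults on the cold pass pay for the potential with which the zigzag starts.
      have h2 := (fwfCostFrom_amortized hk (C := ∅) (by simp) σ).1
      rw [Finset.card_empty, Nat.cast_zero, add_zero] at h2
      rw [fwfCost_eq, fwfCostFrom_append]
      have h3 := mul_le_mul_of_nonneg_left (Nat.cast_le (α := ℝ).mpr hfwf) (Nat.cast_nonneg k)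
      linarith

theorem fwfCost_singleton (k : ℕ) (f : F) : fwfCost k [f] = 1 := by
  simp [fwfCost_eq, fwfCostFrom]

theorem lruCost_singleton (k : ℕ) (f : F) : lruCost k [f] = 1 := by
  simp [lruCost_eq, lruCostFrom]

/-! ### Choice of the parameters -/

theorem tightRatio_nonpos {ε δ : ℝ} (hε : 1 / 2 ≤ ε) (hδ : 0 < δ) : tightRatio ε δ ≤ 0 := by
  have h : Real.logb 2 (1 / (2 * ε)) ≤ 0 :=
    Real.logb_nonpos one_lt_two (by positivity) (by rw [div_le_one (by linarith)]; linarith)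
  exact mul_nonpos_of_nonneg_of_nonpos (by positivity) h

theorem tightRatio_nonneg {ε δ : ℝ} (h0 : 0 < ε) (hε : ε ≤ 1 / 2) (hδ : 0 < δ) :
    0 ≤ tightRatio ε δ := by
  have h : 0 ≤ Real.logb 2 (1 / (2 * ε)) :=
    Real.logb_nonneg one_lt_two (by rw [le_div_iff₀ (by linarith)]; linarith)
  exact mul_nonneg (by positivity) h

/-- The number of levels of the zigzag sequence. -/
theorem exists_levels {ε δ : ℝ} (h0 : 0 < ε) (hε : ε < 1 / 2) (hδ : 0 < δ) :
    ∃ L : ℕ, 0 < L ∧ ε * (2 ^ L - 1) ≤ 1 / 2 ∧ tightRatio ε δ ≤ L / (4 * δ) := by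
  obtain ⟨x, hx⟩ : ∃ x, x = Real.logb 2 (1 / (2 * ε)) := ⟨_, rfl⟩
  have hx0 : 0 ≤ x :=
    hx ▸ Real.logb_nonneg one_lt_two (by rw [le_div_iff₀ (by linarith)]; linarith)
  have key : ∀ L : ℕ, x ≤ 2 * L → tightRatio ε δ ≤ L / (4 * δ) := by
    intro L hL
    rw [tightRatio, ← hx, one_div, inv_mul_eq_div, div_le_div_iff₀ (by linarith) (by linarith)]
    nlinarith
  rcases lt_or_ge x 1 with h | h
  · exact ⟨1, one_pos, by norm_num; linarith, key 1 (by push_cast; linarith)⟩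
  -- Since `x ≥ 1`, rounding down loses at most a factor `2`; this turns `L / (4 δ)` into the `1 /
  -- (8 δ)` of the ratio.
  · refine ⟨⌊x⌋₊, Nat.floor_pos.mpr h, ?_, key _ ?_⟩
    · have h1 : (2 : ℝ) ^ ⌊x⌋₊ ≤ 1 / (2 * ε) := by
        rw [← Real.rpow_natCast]
        calc (2 : ℝ) ^ (⌊x⌋₊ : ℝ) ≤ 2 ^ x :=
              Real.rpow_le_rpow_of_exponent_le one_le_two (Nat.floor_le hx0)
          _ = 1 / (2 * ε) := by
              rw [hx]; exact Real.rpow_logb two_pos (by norm_num) (by positivity)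
      have h2 : ε * 2 ^ ⌊x⌋₊ ≤ ε * (1 / (2 * ε)) := mul_le_mul_of_nonneg_left h1 h0.le
      have h3 : ε * (1 / (2 * ε)) = 1 / 2 := by field_simp
      linarith
    · have h1 := Nat.lt_floor_add_one x
      have h2 : (1 : ℝ) ≤ ⌊x⌋₊ := by exact_mod_cast Nat.floor_pos.mpr h
      linarith

theorem fwf_vs_lru [Infinite F] {ε δ : ℝ} (h0 : 0 < ε) (h1 : ε < 1) (hδ : 0 < δ)
    (hδ' : δ < 1 / 2) :
    ∃ N : ℕ, ∀ n : ℕ, N ≤ n → ∃ r : List F,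
      ∀ k : ℕ, ⌈(1 - δ) * (n : ℝ)⌉₊ ≤ k → k ≤ n →
        tightRatio ε δ * lruCost k r < fwfCost k r ∧ ε * (r.length : ℝ) < fwfCost k r := by
  rcases le_or_gt (1 / 2) ε with hε | hε
  -- The ratio is not positive here, so a single request suffices.
  · obtain ⟨f⟩ : Nonempty F := inferInstance
    refine ⟨0, fun n _ => ⟨[f], fun k _ _ => ?_⟩⟩
    rw [fwfCost_singleton, lruCost_singleton]
    have := tightRatio_nonpos hε hδ
    simp only [List.length_singleton, Nat.cast_one, mul_one]
    exact ⟨by linarith, h1⟩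
  obtain ⟨L, hL, hεL, hc⟩ := exists_levels h0 hε hδ
  have hc0 := tightRatio_nonneg h0 hε.le hδ
  have hL' : (0 : ℝ) < L := Nat.cast_pos.mpr hL
  have hgap : 0 < 1 / 2 - δ := by linarith
  -- The first two terms are the rounding loss in `L / (4 δ) * (1 + 2 b)` beyond `n / 2`; the `2`
  -- covers `ε + 1 / 2` in the second bound. Large `n` gives `(1 - δ) n ≥ n / 2 + A`.
  obtain ⟨A, hA⟩ : ∃ A, A = 3 * L / (4 * δ) + 1 / (2 * δ) + 2 := ⟨_, rfl⟩
  refine ⟨⌈A / (1 / 2 - δ)⌉₊, fun n hn => ?_⟩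
  have hnA : A ≤ n * (1 / 2 - δ) := by
    rw [← div_le_iff₀ hgap]
    exact (Nat.le_ceil _).trans (Nat.cast_le.mpr hn)
  have hA2 : 3 * L / (4 * δ) + 1 / (2 * δ) + 2 ≤ A := hA.ge
  have hA3 : 0 ≤ 3 * L / (4 * δ) + 1 / (2 * δ) := by positivity
  -- This is the least spacing with `L * b ≥ δ n + 1`, so the levels cover every `k ≥ (1 - δ) n`.
  obtain ⟨b, hbdef⟩ : ∃ b, b = ⌈(δ * n + 1) / L⌉₊ := ⟨_, rfl⟩
  have hpos : 0 < (δ * n + 1) / L := by positivity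
  have hb : 0 < b := hbdef ▸ Nat.ceil_pos.mpr hpos
  have hb1 : δ * n + 1 ≤ L * b := by
    rw [mul_comm (L : ℝ), ← div_le_iff₀ hL', hbdef]; exact Nat.le_ceil _
  have hb2 : (b : ℝ) ≤ (δ * n + 1) / L + 1 := by
    rw [hbdef]; exact (Nat.ceil_lt_add_one hpos.le).le
  obtain ⟨r, hr, hcost⟩ := exists_sequence (F := F) (n := n) hL hb
  refine ⟨r, fun k hk hkn => ?_⟩
  have hkR : (1 - δ) * (n : ℝ) ≤ k := Nat.ceil_le.mp hk
  have hk2 : (n : ℝ) / 2 + A ≤ k := by linarith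
  have hk0 : 0 < k := by
    have : (0 : ℝ) < k := by
      have : (0 : ℝ) ≤ n := Nat.cast_nonneg n
      linarith
    exact_mod_cast this
  have hkLb : n + 1 ≤ k + L * b := by
    have : (n : ℝ) + 1 ≤ k + L * b := by linarith
    exact_mod_cast this
  obtain ⟨Q, hQ, hlru, hfwf⟩ := hcost k hk0 hkn hkLb
  have hn1 : (0 : ℝ) < n + 1 := by positivity
  have hQ0 : 0 < Q := hn1.trans_le hQ
  constructor
  · have e1 : tightRatio ε δ * (1 + 2 * b) < k := by
      calc tightRatio ε δ * (1 + 2 * b) ≤ L / (4 * δ) * (1 + 2 * ((δ * n + 1) / L + 1)) := by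
            gcongr
        _ = n / 2 + (3 * L / (4 * δ) + 1 / (2 * δ)) := by field_simp; ring
        _ < k := by linarith
    calc tightRatio ε δ * lruCost k r ≤ tightRatio ε δ * (Q * (1 + 2 * b)) :=
          mul_le_mul_of_nonneg_left (by linarith) hc0
      _ = tightRatio ε δ * (1 + 2 * b) * Q := by ring
      _ < k * Q := mul_lt_mul_of_pos_right e1 hQ0
      _ ≤ fwfCost k r := hfwf
  · have e1 : ε * (1 + (n + 1) * (2 ^ L - 1)) < k := by
      have e2 : (n + 1) * (ε * (2 ^ L - 1)) ≤ ((n : ℝ) + 1) * (1 / 2) :=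
        mul_le_mul_of_nonneg_left hεL hn1.le
      have e3 : ε * (1 + (n + 1) * (2 ^ L - 1)) = ε + (n + 1) * (ε * (2 ^ L - 1)) := by ring
      linarith
    calc ε * (r.length : ℝ) ≤ ε * ((n + 1) * (1 + (n + 1) * (2 ^ L - 1))) :=
          mul_le_mul_of_nonneg_left hr h0.le
      _ = ε * (1 + (n + 1) * (2 ^ L - 1)) * (n + 1) := by ring
      _ < k * (n + 1) := mul_lt_mul_of_pos_right e1 hn1
      _ ≤ k * Q := mul_le_mul_of_nonneg_left hQ (Nat.cast_nonneg k)
      _ ≤ fwfCost k r := hfwf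

end Sequences

/-! ### Consequence for loose competitiveness -/

/-- Every `k` from `m = ⌈(1 - δ) n⌉` to `n` violates the bound, as the optimum is at most LRU. At
most `m - 1 < (1 - δ) n` values remain. -/
theorem not_looselyCompetitive_of_cost_eq_fwfCost {F : Type*} [DecidableEq F] [Infinite F]
    {A : CachingAlg F}
    (hA : ∀ k : ℕ, 0 < k → ∀ r : List F, A.cost (paging F) k r = fwfCost k r)
    {ε δ : ℝ} (h0 : 0 < ε) (h1 : ε < 1) (hδ : 0 < δ) (hδ' : δ < 1 / 2) :
    ¬ LooselyCompetitive A ε δ (tightRatio ε δ) := by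
  intro hcomp
  obtain ⟨N, hN⟩ := fwf_vs_lru (F := F) h0 h1 hδ hδ'
  obtain ⟨r, hr⟩ := hN (N + 1) (Nat.le_succ N)
  have hle := hcomp (N + 1) (Nat.succ_pos N) (paging F) r
  obtain ⟨m, hm⟩ : ∃ m, m = ⌈(1 - δ) * ((N + 1 : ℕ) : ℝ)⌉₊ := ⟨_, rfl⟩
  rw [← hm] at hr
  have hpos : 0 < (1 - δ) * ((N + 1 : ℕ) : ℝ) :=
    mul_pos (by linarith) (Nat.cast_pos.mpr (Nat.succ_pos N))
  have hm0 : 0 < m := hm ▸ Nat.ceil_pos.mpr hpos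
  have hsub : {k : ℕ | 1 ≤ k ∧ k ≤ N + 1 ∧ (Servable (paging F) k r →
      A.cost (paging F) k r ≤ max (tightRatio ε δ * optCost (paging F) k r)
        (ε * (r.map (paging F).cost).sum))} ⊆ (Finset.Icc 1 (m - 1) : Finset ℕ) := by
    rintro k ⟨hk1, hkn, hk⟩
    rw [Finset.mem_coe, Finset.mem_Icc]
    refine ⟨hk1, ?_⟩
    by_contra hlt
    obtain ⟨e1, e2⟩ := hr k (by omega) hkn
    have hlen : (r.map (paging F).cost).sum = r.length := by simp [paging]
    have hc : tightRatio ε δ * optCost (paging F) k r < fwfCost k r := by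
      rcases le_or_gt 0 (tightRatio ε δ) with hc | hc
      · exact (mul_le_mul_of_nonneg_left (optCost_le_lruCost hk1 r) hc).trans_lt e1
      · have e3 : 0 ≤ ε * (r.length : ℝ) := by positivity
        have e4 := mul_nonpos_of_nonpos_of_nonneg hc.le (optCost_nonneg (paging F) k r)
        linarith
    have h := hk fun f _ => hk1
    rw [hA k hk1, hlen] at h
    exact absurd h (not_le.mpr (max_lt hc e2))
  have hcard := Set.ncard_le_ncard hsub (Finset.finite_toSet _)
  rw [Set.ncard_coe_finset, Nat.card_Icc] at hcard
  have h2 : (1 - δ) * ((N + 1 : ℕ) : ℝ) ≤ ((m - 1 : ℕ) : ℝ) :=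
    hle.trans (Nat.cast_le.mpr (by omega))
  have h3 := Nat.ceil_le.mpr h2
  omega

/-! ### The order of growth of the ratio -/

/-- With `u = log (1 / ε)` the ratio is `(u - log 2) / (8 δ log 2)`, and `u / 2 ≤ u - log 2 ≤ u`
once `ε < 1 / 4`. The constants do not involve `δ`, hence the uniformity. -/
theorem tightRatio_isTheta :
    (fun p : ℝ × ℝ => tightRatio p.1 p.2) =Θ[𝓝[>] (0 : ℝ) ×ˢ Filter.principal (Set.Ioo 0 (1 / 2))]
      (fun p : ℝ × ℝ => 1 / p.2 * Real.log (1 / p.1)) := by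
  have hlog2 : 0 < Real.log 2 := Real.log_pos one_lt_two
  have hev : ∀ᶠ p : ℝ × ℝ in 𝓝[>] (0 : ℝ) ×ˢ Filter.principal (Set.Ioo 0 (1 / 2)),
      ∃ u : ℝ, Real.log (1 / p.1) = u ∧ 2 * Real.log 2 ≤ u ∧ 0 < p.2 ∧
        tightRatio p.1 p.2 = 1 / p.2 * ((u - Real.log 2) / (8 * Real.log 2)) := by
    have h1 : ∀ᶠ x : ℝ in 𝓝[>] (0 : ℝ), x ∈ Set.Ioo (0 : ℝ) (1 / 4) :=
      Ioo_mem_nhdsGT (by norm_num)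
    have h2 : ∀ᶠ y : ℝ in Filter.principal (Set.Ioo (0 : ℝ) (1 / 2)), y ∈ Set.Ioo (0 : ℝ) (1 / 2) :=
      Filter.mem_principal_self _
    filter_upwards [h1.prod_mk h2] with p hp
    obtain ⟨⟨hx0, hx1⟩, hy0, -⟩ := hp
    refine ⟨_, rfl, ?_, hy0, ?_⟩
    · have h4 : 2 * Real.log 2 = Real.log 4 := by
        rw [show (4 : ℝ) = 2 ^ 2 by norm_num, Real.log_pow]; norm_num
      rw [h4]
      apply Real.log_le_log (by norm_num)
      rw [le_div_iff₀ hx0]; linarith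
    · have h5 : Real.log (1 / (2 * p.1)) = Real.log (1 / p.1) - Real.log 2 := by
        rw [one_div, one_div, Real.log_inv, Real.log_inv, Real.log_mul (by norm_num) hx0.ne']
        ring
      rw [tightRatio, Real.logb, h5]
      field_simp
  constructor
  · refine Asymptotics.IsBigO.of_bound (1 / (8 * Real.log 2)) ?_
    filter_upwards [hev] with p ⟨u, hu, hu2, hp, ht⟩
    rw [ht, hu, Real.norm_of_nonneg, Real.norm_of_nonneg]
    · rw [mul_left_comm]
      refine mul_le_mul_of_nonneg_left ?_ (by positivity)
      rw [div_eq_inv_mul, one_div]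
      exact mul_le_mul_of_nonneg_left (by linarith) (by positivity)
    · exact mul_nonneg (by positivity) (by linarith)
    · exact mul_nonneg (by positivity) (div_nonneg (by linarith) (by positivity))
  · refine Asymptotics.IsBigO.of_bound (16 * Real.log 2) ?_
    filter_upwards [hev] with p ⟨u, hu, hu2, hp, ht⟩
    rw [ht, hu, Real.norm_of_nonneg, Real.norm_of_nonneg]
    · rw [mul_left_comm]
      refine mul_le_mul_of_nonneg_left ?_ (by positivity)
      have : 16 * Real.log 2 * ((u - Real.log 2) / (8 * Real.log 2)) = 2 * (u - Real.log 2) := by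
        field_simp; ring
      rw [this]; linarith
    · exact mul_nonneg (by positivity) (div_nonneg (by linarith) (by positivity))
    · exact mul_nonneg (by positivity) (by linarith)

end FileCaching

namespace FileCaching

section Landlord

variable {F : Type*} [DecidableEq F]

/-! ### Every execution of Landlord is a legal schedule -/

theorem MakeRoom.cache_subset {S : FileSystem F} {P : Finset F → Prop} {k : ℕ} {g : F}
    {s u : LandlordState F} (h : MakeRoom S P k g s u) : u.cache ⊆ s.cache := by
  induction h with
  | done s _ => exact subset_rfl
  | loop s t u _ hst _ ih =>
    obtain ⟨Δ, -, -, E, -, -, -, ht⟩ := hst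
    exact ih.trans (ht ▸ Finset.sdiff_subset)

theorem MakeRoom.hasRoom {S : FileSystem F} {P : Finset F → Prop} {k : ℕ} {g : F}
    {s u : LandlordState F} (h : MakeRoom S P k g s u) : HasRoom S k g u := by
  induction h with
  | done s h => exact h
  | loop s t u _ _ _ ih => exact ih

theorem LandlordRun.isSchedule {S : FileSystem F} {P : Finset F → Prop} {k : ℕ}
    {s : LandlordState F} {r : List F} {Cs : List (Finset F)} (h : LandlordRun S P k s r Cs)
    (hs : ∑ f ∈ s.cache, S.size f ≤ k) : IsSchedule S k s.cache r Cs := by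
  induction h with
  | nil s => simp [IsSchedule]
  | cons s t g r Cs hst _ ih =>
    rcases hst with ⟨hg, u, hu, ht, -⟩ | ⟨hg, ht, -⟩
    · have hgu : g ∉ u.cache := fun h => hg (hu.cache_subset h)
      have hsum : ∑ f ∈ t.cache, S.size f ≤ k := by
        have := hu.hasRoom
        rw [HasRoom] at this
        rw [ht, Finset.sum_insert hgu]
        omega
      exact ⟨by simp [ht], ht ▸ Finset.insert_subset_insert g hu.cache_subset, hsum, ih hsum⟩
    · have hsum : ∑ f ∈ t.cache, S.size f ≤ k := by rwa [ht]
      exact ⟨by rwa [ht], ht ▸ Finset.subset_insert _ _, hsum, ih hsum⟩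

/-! ### Landlord with a rule for the choice of the files to evict

The rule `sel` maps the set of zero-credit files in the cache to the set of files to evict. The
credit of a requested file in the cache is left as it is. -/

/-- The amount `Δ` by which the credits decrease, per unit of size. -/
noncomputable def rentRate (S : FileSystem F) (s : LandlordState F) : ℝ :=
  if h : s.cache.Nonempty then s.cache.inf' h fun f => s.credit f / (S.size f : ℝ) else 0

/-- The credit that is left after the decrease. -/
noncomputable def creditAfterRent (S : FileSystem F) (s : LandlordState F) (f : F) : ℝ :=
  s.credit f - rentRate S s * (S.size f : ℝ)

/-- The files in the cache that have no credit left after the decrease. -/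
noncomputable def brokeFiles (S : FileSystem F) (s : LandlordState F) : Finset F :=
  s.cache.filter fun f => creditAfterRent S s f = 0

/-- One iteration of the inner loop, with the rule `sel`. -/
noncomputable def rentEvict (S : FileSystem F) (sel : Finset F → Finset F)
    (s : LandlordState F) : LandlordState F :=
  ⟨s.cache \ sel (brokeFiles S s), creditAfterRent S s⟩

/-- One iteration of the inner loop, unless there is room. -/
noncomputable def roomStep (S : FileSystem F) (sel : Finset F → Finset F) (k : ℕ) (g : F)
    (s : LandlordState F) : LandlordState F :=
  if ∑ f ∈ s.cache, S.size f + S.size g ≤ k then s else rentEvict S sel s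

/-- The inner loop, with the rule `sel`. -/
noncomputable def makeRoom (S : FileSystem F) (sel : Finset F → Finset F) (k : ℕ) (g : F)
    (s : LandlordState F) : LandlordState F :=
  (roomStep S sel k g)^[s.cache.card] s

/-- The response to a request, with the rule `sel`. -/
noncomputable def serve (S : FileSystem F) (sel : Finset F → Finset F) (k : ℕ)
    (s : LandlordState F) (g : F) : LandlordState F :=
  if g ∈ s.cache then s
  else ⟨insert g (makeRoom S sel k g s).cache,
    Function.update (makeRoom S sel k g s).credit g (S.cost g)⟩

/-- The cache contents after each request, where the rule may depend on the later requests. -/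
noncomputable def landlordSchedule (S : FileSystem F) (sel : List F → Finset F → Finset F) (k : ℕ) :
    LandlordState F → List F → List (Finset F)
  | _, [] => []
  | s, g :: r => (serve S (sel r) k s g).cache ::
      landlordSchedule S sel k (serve S (sel r) k s g) r

/-- The rule evicts a nonempty set of zero-credit files that satisfies `P`. -/
def ValidRule (P : Finset F → Prop) (sel : Finset F → Finset F) : Prop :=
  ∀ Z : Finset F, Z.Nonempty → sel Z ⊆ Z ∧ (sel Z).Nonempty ∧ P (sel Z)

/-- The credits of the files in the cache are between `0` and the retrieval cost. -/
def CreditsBounded (S : FileSystem F) (s : LandlordState F) : Prop :=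
  ∀ f ∈ s.cache, 0 ≤ s.credit f ∧ s.credit f ≤ S.cost f

theorem isLeast_rentRate {F : Type*} (S : FileSystem F) {s : LandlordState F} (h : s.cache.Nonempty) :
    IsLeast ((fun f => s.credit f / (S.size f : ℝ)) '' (s.cache : Set F)) (rentRate S s) := by
  rw [rentRate, dif_pos h]
  constructor
  · obtain ⟨f, hf, he⟩ := s.cache.exists_mem_eq_inf' h fun f => s.credit f / (S.size f : ℝ)
    exact ⟨f, hf, he.symm⟩
  · rintro _ ⟨f, hf, rfl⟩
    exact Finset.inf'_le _ hf

theorem brokeFiles_subset {F : Type*} (S : FileSystem F) (s : LandlordState F) :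
    brokeFiles S s ⊆ s.cache :=
  Finset.filter_subset _ _

theorem brokeFiles_nonempty {F : Type*} (S : FileSystem F) {s : LandlordState F} (h : s.cache.Nonempty) :
    (brokeFiles S s).Nonempty := by
  obtain ⟨f, hf, he⟩ := (isLeast_rentRate S h).1
  have hpos : (S.size f : ℝ) ≠ 0 := Nat.cast_ne_zero.mpr (S.size_pos f).ne'
  refine ⟨f, Finset.mem_filter.mpr ⟨hf, ?_⟩⟩
  rw [creditAfterRent, ← he]
  field_simp
  ring

/-- Nonnegative credits give `Δ ≥ 0`, so no credit rises; minimality of `Δ` keeps them nonnegative.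
The upper bound is what makes leaving the credit unchanged on a hit a legal choice. -/
theorem CreditsBounded.rentEvict {S : FileSystem F} {sel : Finset F → Finset F}
    {s : LandlordState F} (hs : CreditsBounded S s) : CreditsBounded S (rentEvict S sel s) := by
  intro f hf
  have hf' : f ∈ s.cache := Finset.sdiff_subset hf
  have hpos : (0 : ℝ) < S.size f := Nat.cast_pos.mpr (S.size_pos f)
  obtain ⟨⟨f₀, hf₀, he⟩, hle⟩ := isLeast_rentRate S ⟨f, hf'⟩
  have h0 : 0 ≤ rentRate S s := he ▸ div_nonneg (hs f₀ hf₀).1 (Nat.cast_nonneg _)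
  have h1 : rentRate S s * S.size f ≤ s.credit f := (le_div_iff₀ hpos).mp (hle ⟨f, hf', rfl⟩)
  have h2 := (hs f hf').2
  have h3 := mul_nonneg h0 hpos.le
  change 0 ≤ s.credit f - rentRate S s * S.size f ∧ s.credit f - rentRate S s * S.size f ≤ S.cost f
  constructor <;> linarith

theorem rentEvict_spec {S : FileSystem F} {P : Finset F → Prop} {sel : Finset F → Finset F}
    (hsel : ValidRule P sel) {s : LandlordState F} (h : s.cache.Nonempty) :
    RentEvict S P s (rentEvict S sel s) ∧ (rentEvict S sel s).cache.card < s.cache.card := by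
  obtain ⟨h1, h2, h3⟩ := hsel _ (brokeFiles_nonempty S h)
  have h4 := h1.trans (brokeFiles_subset S s)
  refine ⟨⟨rentRate S s, isLeast_rentRate S h, fun _ _ => rfl, _, h4, fun f hf => ?_, h3, rfl⟩, ?_⟩
  · exact (Finset.mem_filter.mp (h1 hf)).2
  · exact Finset.card_lt_card (Finset.sdiff_ssubset h4 h2)

theorem iterate_roomStep_of_hasRoom {S : FileSystem F} {sel : Finset F → Finset F} {k : ℕ} {g : F}
    {s : LandlordState F} (h : HasRoom S k g s) (m : ℕ) : (roomStep S sel k g)^[m] s = s :=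
  Function.iterate_fixed (show roomStep S sel k g s = s from if_pos h) m

/-- Each effective iteration evicts a file, and an empty cache has room for `g`. Hence as many
iterations as there are cached files finish the loop, and any further ones change nothing. -/
theorem iterate_roomStep_spec {S : FileSystem F} {P : Finset F → Prop} {sel : Finset F → Finset F}
    (hsel : ValidRule P sel) {k : ℕ} {g : F} (hg : S.size g ≤ k) (m : ℕ) {s : LandlordState F}
    (hs : CreditsBounded S s) (hm : s.cache.card ≤ m) :
    MakeRoom S P k g s ((roomStep S sel k g)^[m] s) ∧
      CreditsBounded S ((roomStep S sel k g)^[m] s) := by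
  induction m generalizing s with
  | zero =>
    have he : s.cache = ∅ := Finset.card_eq_zero.mp (Nat.le_zero.mp hm)
    exact ⟨.done s (by simpa [HasRoom, he] using hg), hs⟩
  | succ m ih =>
    by_cases hr : HasRoom S k g s
    · rw [iterate_roomStep_of_hasRoom hr]
      exact ⟨.done s hr, hs⟩
    · have hne : s.cache.Nonempty := by
        by_contra he
        rw [Finset.not_nonempty_iff_eq_empty] at he
        exact hr (by simpa [HasRoom, he] using hg)
      have hstep : roomStep S sel k g s = rentEvict S sel s := if_neg hr
      obtain ⟨h1, h2⟩ := rentEvict_spec (S := S) hsel hne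
      rw [Function.iterate_succ_apply, hstep]
      obtain ⟨h3, h4⟩ := ih (hs.rentEvict (sel := sel)) (by omega)
      exact ⟨.loop s _ _ hr h1 h3, h4⟩

theorem serve_spec {S : FileSystem F} {P : Finset F → Prop} {sel : Finset F → Finset F}
    (hsel : ValidRule P sel) {k : ℕ} {g : F} (hg : S.size g ≤ k) {s : LandlordState F}
    (hs : CreditsBounded S s) :
    LandlordStep S P k s g (serve S sel k s g) ∧ CreditsBounded S (serve S sel k s g) := by
  unfold serve
  split_ifs with h
  · exact ⟨Or.inr ⟨h, rfl, le_rfl, (hs g h).2, fun _ _ _ => rfl⟩, hs⟩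
  · obtain ⟨h1, h2⟩ := iterate_roomStep_spec hsel hg s.cache.card hs le_rfl
    change MakeRoom S P k g s (makeRoom S sel k g s) at h1
    change CreditsBounded S (makeRoom S sel k g s) at h2
    have hgu : g ∉ (makeRoom S sel k g s).cache := fun h' => h (h1.cache_subset h')
    have hne : ∀ f ∈ (makeRoom S sel k g s).cache, f ≠ g := fun f hf he => hgu (he ▸ hf)
    refine ⟨Or.inl ⟨h, _, h1, rfl, by simp, fun f hf => by simp [hne f hf]⟩, ?_⟩
    intro f hf
    rcases Finset.mem_insert.mp hf with rfl | hf
    · simpa using S.cost_nonneg f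
    · simpa [hne f hf] using h2 f hf

theorem landlordRun_landlordSchedule {S : FileSystem F} {P : Finset F → Prop}
    {sel : List F → Finset F → Finset F} (hsel : ∀ r, ValidRule P (sel r)) {k : ℕ} {r : List F}
    (hr : Servable S k r) {s : LandlordState F} (hs : CreditsBounded S s) :
    LandlordRun S P k s r (landlordSchedule S sel k s r) := by
  induction r generalizing s with
  | nil => exact .nil s
  | cons g r ih =>
    obtain ⟨h1, h2⟩ := serve_spec (hsel r) (hr g (List.mem_cons_self ..)) hs
    exact .cons s _ g r _ h1 (ih (fun f hf => hr f (List.mem_cons_of_mem _ hf)) h2)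

theorem creditsBounded_empty {F : Type*} (S : FileSystem F) : CreditsBounded S ⟨∅, fun _ => 0⟩ := by
  simp [CreditsBounded]

/-- Landlord, with a rule for the choice of the files to evict. -/
noncomputable def landlordAlg (sel : List F → Finset F → Finset F) (P : Finset F → Prop)
    (hsel : ∀ r, ValidRule P (sel r)) : CachingAlg F where
  schedule S k r := landlordSchedule S sel k ⟨∅, fun _ => 0⟩ r
  valid S k r hr :=
    (landlordRun_landlordSchedule hsel hr (creditsBounded_empty S)).isSchedule (by simp)

theorem landlordAlg_run {sel : List F → Finset F → Finset F} {P : Finset F → Prop}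
    (hsel : ∀ r, ValidRule P (sel r)) (S : FileSystem F) (k : ℕ) (r : List F)
    (hr : Servable S k r) :
    LandlordRun S P k ⟨∅, fun _ => 0⟩ r ((landlordAlg sel P hsel).schedule S k r) :=
  landlordRun_landlordSchedule hsel hr (creditsBounded_empty S)

theorem landlordSchedule_prefix (S : FileSystem F) (sel : Finset F → Finset F) (k : ℕ)
    (s : LandlordState F) (r r' : List F) :
    landlordSchedule S (fun _ => sel) k s r <+: landlordSchedule S (fun _ => sel) k s (r ++ r') := by
  induction r generalizing s with
  | nil => exact List.nil_prefix
  | cons g r ih => exact List.cons_prefix_cons.mpr ⟨rfl, ih _⟩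

/-! ### Landlord on paging sequences -/

theorem hasRoom_paging {F : Type*} {k : ℕ} {g : F} {s : LandlordState F} :
    HasRoom (paging F) k g s ↔ s.cache.card < k := by
  simp only [HasRoom, paging, Finset.sum_const, smul_eq_mul, mul_one]
  exact Nat.succ_le_iff

theorem makeRoom_of_hasRoom {S : FileSystem F} {sel : Finset F → Finset F} {k : ℕ} {g : F}
    {s : LandlordState F} (h : HasRoom S k g s) : makeRoom S sel k g s = s :=
  iterate_roomStep_of_hasRoom h _

theorem makeRoom_of_hasRoom_rentEvict {S : FileSystem F} {sel : Finset F → Finset F} {k : ℕ}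
    {g : F} {s : LandlordState F} (hne : s.cache.Nonempty) (h : ¬ HasRoom S k g s)
    (h' : HasRoom S k g (rentEvict S sel s)) : makeRoom S sel k g s = rentEvict S sel s := by
  obtain ⟨m, hm⟩ : ∃ m, s.cache.card = m + 1 :=
    ⟨s.cache.card - 1, by have := hne.card_pos; omega⟩
  have hstep : roomStep S sel k g s = rentEvict S sel s := if_neg h
  rw [makeRoom, hm, Function.iterate_succ_apply, hstep, iterate_roomStep_of_hasRoom h']

theorem creditAfterRent_paging {F : Type*} {s : LandlordState F} {a : ℝ} {f₀ : F} (hf₀ : f₀ ∈ s.cache)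
    (ha : s.credit f₀ = a) (hle : ∀ f ∈ s.cache, a ≤ s.credit f) (f : F) :
    creditAfterRent (paging F) s f = s.credit f - a := by
  have h := isLeast_rentRate (paging F) ⟨f₀, hf₀⟩
  have h' : IsLeast ((fun f => s.credit f / ((paging F).size f : ℝ)) '' (s.cache : Set F)) a := by
    refine ⟨⟨f₀, hf₀, by simp [paging, ha]⟩, ?_⟩
    rintro _ ⟨f, hf, rfl⟩
    simpa [paging] using hle f hf
  rw [creditAfterRent, h.unique h']
  simp [paging]

/-- Evicting all zero-credit files amounts to flush-when-full. -/
theorem landlordSchedule_evictAll {k : ℕ} (hk : 0 < k) (r : List F) {s : LandlordState F}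
    (hcard : s.cache.card ≤ k) (hs : ∀ f ∈ s.cache, s.credit f = 1) :
    landlordSchedule (paging F) (fun _ Z => Z) k s r = (r.scanl (fwfStep k) s.cache).tail := by
  induction r generalizing s with
  | nil => simp [landlordSchedule]
  | cons g r ih =>
    have key : (serve (paging F) (fun Z => Z) k s g).cache = fwfStep k s.cache g ∧
        ∀ f ∈ (serve (paging F) (fun Z => Z) k s g).cache,
          (serve (paging F) (fun Z => Z) k s g).credit f = 1 := by
      unfold serve fwfStep
      by_cases hg : g ∈ s.cache
      · simpa [hg] using hs
      by_cases hlt : s.cache.card < k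
      · rw [makeRoom_of_hasRoom (hasRoom_paging.mpr hlt)]
        simp only [hg, hlt, if_false, if_true, true_and]
        intro f hf
        by_cases hfg : f = g
        · subst hfg; simp [paging]
        · simpa [hfg] using hs f (Finset.mem_of_mem_insert_of_ne hf hfg)
      · have hne : s.cache.Nonempty := Finset.card_pos.mp (by omega)
        obtain ⟨f₀, hf₀⟩ := id hne
        -- All credits are `1`, so the decrease is `1` and leaves every file without credit.
        have hb : brokeFiles (paging F) s = s.cache := by
          apply Finset.filter_true_of_mem
          intro f hf
          rw [creditAfterRent_paging hf₀ (hs f₀ hf₀) (fun f hf => (hs f hf).ge), hs f hf, sub_self]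
        have hc : (rentEvict (paging F) (fun Z => Z) s).cache = ∅ := by
          simp [rentEvict, hb]
        rw [makeRoom_of_hasRoom_rentEvict hne (mt hasRoom_paging.mp hlt)
          (hasRoom_paging.mpr (by rw [hc]; simpa using hk)), hc]
        simp [hg, hlt, paging]
    rw [landlordSchedule, tail_scanl_cons, ← key.1]
    refine congrArg _ (ih ?_ key.2)
    rw [key.1]
    exact card_fwfStep_le hk hcard g

/-! ### Eviction one at a time on paging sequences -/

/-- The zero-credit file that is requested soonest. -/
noncomputable def soonest (r : List F) (Z : Finset F) : Finset F :=
  if h : Z.Nonempty then {(Z.exists_min_image (fun x => r.idxOf x) h).choose} else ∅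

theorem exists_soonest (r : List F) {Z : Finset F} (h : Z.Nonempty) :
    ∃ x ∈ Z, soonest r Z = {x} ∧ ∀ y ∈ Z, r.idxOf x ≤ r.idxOf y := by
  have hx := (Z.exists_min_image (fun x => r.idxOf x) h).choose_spec
  exact ⟨_, hx.1, dif_pos h, hx.2⟩

theorem validRule_soonest (r : List F) : ValidRule (fun E => E.card = 1) (soonest r) := by
  intro Z hZ
  obtain ⟨x, hx, he, -⟩ := exists_soonest r hZ
  simp [he, hx]

/-- The first entry satisfying `p` precedes every other item satisfying `p`; items absent from `r`
have `idxOf` equal to its length and so come last. -/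
theorem eq_of_find?_eq_some {p : F → Bool} {r : List F} {x y : F} (hy : r.find? p = some y)
    (hx : p x) (hle : r.idxOf x ≤ r.idxOf y) : x = y := by
  induction r with
  | nil => simp at hy
  | cons a r ih =>
    rw [List.find?_cons] at hy
    by_cases ha : p a
    · simp only [ha, Option.some.injEq] at hy
      subst hy
      by_contra hne
      rw [List.idxOf_cons_self, List.idxOf_cons_ne _ (Ne.symm hne)] at hle
      omega
    · have hy' : r.find? p = some y := by simpa [ha] using hy
      have hxa : a ≠ x := fun h => ha (h ▸ hx)
      have hya : a ≠ y := fun h => ha (h ▸ List.find?_some hy')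
      rw [List.idxOf_cons_ne _ hxa, List.idxOf_cons_ne _ hya] at hle
      exact ih hy' (by omega)

/-- The relation between the state of Landlord, evicting the file requested soonest, and the cache
contents `D` of flush-when-full: the files of `D` have credit `1`, the other files in the cache have
credit `0`, and the next one of the requests `r` to a file outside of `D` is a fault for both. -/
structure Simulates (k : ℕ) (s : LandlordState F) (D : Finset F) (r : List F) : Prop where
  subset : D ⊆ s.cache
  card_le : s.cache.card ≤ k
  credit_one : ∀ f ∈ D, s.credit f = 1
  credit_zero : ∀ f ∈ s.cache, f ∉ D → s.credit f = 0
  eq_or_card_eq : s.cache = D ∨ s.cache.card = k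
  next_fault : ∀ y, r.find? (fun y => decide (y ∉ D)) = some y → y ∉ s.cache

/-- Only the next request outside `D` has to be guarded: when it arrives it is a fault, and the
eviction that it forces, once the cache is full, removes the leftover that would be requested next.
-/
theorem Simulates.step {k : ℕ} (hk : 0 < k) {s : LandlordState F} {D : Finset F} {g : F}
    {r : List F} (h : Simulates k s D (g :: r)) :
    Simulates k (serve (paging F) (soonest r) k s g) (fwfStep k D g) r ∧
      (g ∈ s.cache ↔ g ∈ D) := by
  by_cases hgD : g ∈ D
  · have hgs := h.subset hgD
    have hnext := h.next_fault
    simp only [List.find?_cons, hgD, not_true, decide_false] at hnext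
    rw [serve, fwfStep, if_pos hgs, if_pos hgD]
    exact ⟨⟨h.subset, h.card_le, h.credit_one, h.credit_zero, h.eq_or_card_eq, hnext⟩, by tauto⟩
  have hgs : g ∉ s.cache := h.next_fault g (by simp [hgD])
  refine ⟨?_, by tauto⟩
  rw [serve, fwfStep, if_neg hgs, if_neg hgD]
  by_cases hlt : s.cache.card < k
  · have hsD : s.cache = D := h.eq_or_card_eq.resolve_right hlt.ne
    rw [makeRoom_of_hasRoom (hasRoom_paging.mpr hlt), if_pos (hsD ▸ hlt), hsD]
    refine ⟨subset_rfl, ?_, ?_, fun f hf hf' => absurd hf hf', Or.inl rfl, ?_⟩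
    · rw [Finset.card_insert_of_notMem hgD, ← hsD]; exact hlt
    · intro f hf
      by_cases hfg : f = g
      · subst hfg; simp [paging]
      · simpa [hfg] using h.credit_one f (Finset.mem_of_mem_insert_of_ne hf hfg)
    · intro y hy
      simpa using List.find?_some hy
  -- The cache is full; `D'` is what flush-when-full keeps.
  have hfull : s.cache.card = k := le_antisymm h.card_le (not_lt.mp hlt)
  have hne : s.cache.Nonempty := Finset.card_pos.mp (by omega)
  obtain ⟨D', hD's, hfwf, hbroke, hone⟩ : ∃ D' ⊆ s.cache,
      (if D.card < k then insert g D else {g}) = insert g D' ∧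
      brokeFiles (paging F) s = s.cache \ D' ∧
      ∀ f ∈ D', creditAfterRent (paging F) s f = 1 := by
    by_cases hD : D.card < k
    · refine ⟨D, h.subset, if_pos hD, ?_⟩
      obtain ⟨f₀, hf₀, hf₀D⟩ : ∃ f ∈ s.cache, f ∉ D :=
        Finset.exists_mem_notMem_of_card_lt_card (by omega)
      have hle : ∀ f ∈ s.cache, 0 ≤ s.credit f := by
        intro f hf
        by_cases hfD : f ∈ D
        · rw [h.credit_one f hfD]; exact zero_le_one
        · rw [h.credit_zero f hf hfD]
      -- A leftover `f₀` has credit `0`, so `Δ = 0` and the credits do not change.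
      have hcr := creditAfterRent_paging hf₀ (h.credit_zero f₀ hf₀ hf₀D) hle
      refine ⟨?_, fun f hf => by rw [hcr, h.credit_one f hf, sub_zero]⟩
      ext f
      simp only [brokeFiles, Finset.mem_filter, Finset.mem_sdiff, hcr, sub_zero]
      refine and_congr_right fun hf => ⟨fun h0 hfD => ?_, h.credit_zero f hf⟩
      rw [h.credit_one f hfD] at h0
      exact one_ne_zero h0
    -- Here FWF flushes: all credits drop from `1` to `0`, and the whole old cache becomes
    -- leftovers.
    · have hsD : D = s.cache := Finset.eq_of_subset_of_card_le h.subset (by omega)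
      refine ⟨∅, Finset.empty_subset _, by simp [hD], ?_, by simp⟩
      obtain ⟨f₀, hf₀⟩ := hne
      have hs : ∀ f ∈ s.cache, s.credit f = 1 := fun f hf => h.credit_one f (hsD ▸ hf)
      rw [Finset.sdiff_empty]
      apply Finset.filter_true_of_mem
      intro f hf
      rw [creditAfterRent_paging hf₀ (hs f₀ hf₀) (fun f hf => (hs f hf).ge), hs f hf, sub_self]
  obtain ⟨x, hx, hsx, hmin⟩ := exists_soonest r (brokeFiles_nonempty (paging F) hne)
  have hxs := brokeFiles_subset _ _ hx
  have hxD' : x ∉ D' := by rw [hbroke] at hx; exact (Finset.mem_sdiff.mp hx).2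
  have hcache : (rentEvict (paging F) (soonest r) s).cache = s.cache \ {x} := by
    rw [← hsx]; rfl
  have hcard : (s.cache \ {x}).card + 1 = k := by
    rw [Finset.card_sdiff_of_subset (Finset.singleton_subset_iff.mpr hxs), Finset.card_singleton]
    omega
  rw [makeRoom_of_hasRoom_rentEvict hne (mt hasRoom_paging.mp hlt)
    (hasRoom_paging.mpr (by rw [hcache]; omega)), hfwf, hcache]
  have hgx : g ∉ s.cache \ {x} := fun h' => hgs (Finset.sdiff_subset h')
  have hcard' : (insert g (s.cache \ {x})).card = k := by
    rw [Finset.card_insert_of_notMem hgx, hcard]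
  refine ⟨?_, hcard'.le, ?_, ?_, Or.inr hcard', ?_⟩
  · refine Finset.insert_subset_insert g fun f hf => ?_
    rw [Finset.mem_sdiff, Finset.mem_singleton]
    exact ⟨hD's hf, fun hfx => hxD' (hfx ▸ hf)⟩
  · intro f hf
    by_cases hfg : f = g
    · subst hfg; simp [paging]
    · simpa [hfg, rentEvict] using hone f (Finset.mem_of_mem_insert_of_ne hf hfg)
  · intro f hf hf'
    rw [Finset.mem_insert, not_or] at hf'
    have hfb : f ∈ brokeFiles (paging F) s := by
      rw [hbroke, Finset.mem_sdiff]
      exact ⟨Finset.sdiff_subset (Finset.mem_of_mem_insert_of_ne hf hf'.1), hf'.2⟩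
    simpa [hf'.1, rentEvict] using (Finset.mem_filter.mp hfb).2
  · intro y hy hmem
    have hyD : y ∉ insert g D' := by simpa using List.find?_some hy
    rw [Finset.mem_insert, not_or] at hyD
    have hys := Finset.mem_sdiff.mp (Finset.mem_of_mem_insert_of_ne hmem hyD.1)
    have hyb : y ∈ brokeFiles (paging F) s := by
      rw [hbroke, Finset.mem_sdiff]; exact ⟨hys.1, hyD.2⟩
    have hxg : x ≠ g := fun he => hgs (he ▸ hxs)
    -- A leftover `y` requested next outside the new FWF cache would have to be the evicted file
    -- `x`.
    have := eq_of_find?_eq_some hy (by simp [hxg, hxD']) (hmin y hyb)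
    exact hys.2 (by simp [this])

/-- Evicting the zero-credit file that is requested soonest costs as much as flush-when-full. -/
theorem scheduleCost_soonest {k : ℕ} (hk : 0 < k) (r : List F) {s : LandlordState F}
    {D : Finset F} (h : Simulates k s D r) :
    scheduleCost (paging F) s.cache r (landlordSchedule (paging F) soonest k s r) =
      fwfCostFrom k D r := by
  induction r generalizing s D with
  | nil => simp [scheduleCost, fwfCostFrom]
  | cons g r ih =>
    obtain ⟨h1, h2⟩ := h.step hk
    rw [landlordSchedule, scheduleCost, fwfCostFrom, ih h1]
    simp [h2, paging]

/-! ### The two versions of Landlord -/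

theorem exists_landlord_eq_fwf (F : Type*) [DecidableEq F] :
    ∃ A : CachingAlg F, IsLandlord A ∧ A.OnLine ∧
      ∀ k : ℕ, 0 < k → ∀ r : List F, A.schedule (paging F) k r = fwfSchedule k r := by
  have hsel : ∀ _ : List F, ValidRule (fun _ => True) fun Z : Finset F => Z :=
    fun _ Z hZ => ⟨subset_rfl, hZ, trivial⟩
  refine ⟨landlordAlg (fun _ Z => Z) (fun _ => True) hsel, landlordAlg_run hsel, ?_, ?_⟩
  · intro S k r r'
    exact landlordSchedule_prefix S _ k _ r r'
  · intro k hk r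
    exact landlordSchedule_evictAll hk r (by simp) (by simp)

theorem exists_oneAtATimeLandlord_cost_eq_fwf (F : Type*) [DecidableEq F] :
    ∃ B : CachingAlg F, IsOneAtATimeLandlord B ∧
      ∀ k : ℕ, 0 < k → ∀ r : List F, B.cost (paging F) k r = fwfCost k r := by
  refine ⟨landlordAlg soonest _ validRule_soonest, landlordAlg_run validRule_soonest, ?_⟩
  intro k hk r
  rw [fwfCost_eq]
  refine scheduleCost_soonest hk r (s := ⟨∅, fun _ => 0⟩) ?_
  exact ⟨subset_rfl, by simp, by simp, by simp, Or.inl rfl, by simp⟩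

end Landlord

end FileCaching

open FileCaching

theorem theorem4 (F : Type*) [DecidableEq F] [Infinite F] :
    -- `A` is a version of Landlord that specializes to flush-when-full for paging
    (∃ A : CachingAlg F, IsLandlord A ∧ A.OnLine ∧
      (∀ k : ℕ, 0 < k → ∀ r : List F, A.schedule (paging F) k r = fwfSchedule k r) ∧
      ∀ ε δ : ℝ, 0 < ε → ε < 1 → 0 < δ → δ < 1 / 2 →
        ¬ LooselyCompetitive A ε δ (tightRatio ε δ)) ∧
    -- the same for a version that evicts one file at a time
    (∃ B : CachingAlg F, IsOneAtATimeLandlord B ∧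
      (∀ k : ℕ, 0 < k → ∀ r : List F, B.cost (paging F) k r = fwfCost k r) ∧
      ∀ ε δ : ℝ, 0 < ε → ε < 1 → 0 < δ → δ < 1 / 2 →
        ¬ LooselyCompetitive B ε δ (tightRatio ε δ)) ∧
    -- flush-when-full against least-recently-used on one sequence, for all the large cache sizes
    (∀ ε δ : ℝ, 0 < ε → ε < 1 → 0 < δ → δ < 1 / 2 →
      ∃ N : ℕ, ∀ n : ℕ, N ≤ n → ∃ r : List F,
        ∀ k : ℕ, ⌈(1 - δ) * (n : ℝ)⌉₊ ≤ k → k ≤ n →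
          tightRatio ε δ * lruCost k r < fwfCost k r ∧
          ε * (r.length : ℝ) < fwfCost k r) ∧
    -- the order of growth of the ratio as `ε` tends to `0`, uniformly in `δ`
    (fun p : ℝ × ℝ => tightRatio p.1 p.2) =Θ[𝓝[>] (0 : ℝ) ×ˢ Filter.principal (Set.Ioo 0 (1 / 2))]
      (fun p : ℝ × ℝ => 1 / p.2 * Real.log (1 / p.1)) := by
  obtain ⟨A, hA, hon, hsched⟩ := exists_landlord_eq_fwf F
  obtain ⟨B, hB, hcost⟩ := exists_oneAtATimeLandlord_cost_eq_fwf F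
  refine ⟨⟨A, hA, hon, hsched, fun ε δ h0 h1 hδ hδ' => ?_⟩,
    ⟨B, hB, hcost, fun ε δ h0 h1 hδ hδ' =>
      not_looselyCompetitive_of_cost_eq_fwfCost hcost h0 h1 hδ hδ'⟩,
    fun ε δ h0 h1 hδ hδ' => fwf_vs_lru h0 h1 hδ hδ', tightRatio_isTheta⟩
  refine not_looselyCompetitive_of_cost_eq_fwfCost (fun k hk r => ?_) h0 h1 hδ hδ'
  rw [CachingAlg.cost, hsched k hk r, fwfCost]
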